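/- A \emph{modal pseudocomplemented De Morgan algebra} ($mpM$-algebra) is an algebra $\langle A,\wedge,\vee,\sim,{}^*,0,1\rangle$ such that $\langle A,\wedge,\vee,0,1\rangle$ is a bounded distributive lattice, $\sim\sim x=x$ and $\sim(x\wedge y)=\sim x\vee\sim y$, $a^*$ is the pseudocomplement of $a$ (that is, $a\wedge x=0$ if and only if $x\le a^*$), and $x\vee\sim x\le x\vee x^*$. For an integer $k\ge 1$, a \emph{${\cal C}_k$-algebra} is a pair $(A,t)$ where $A$ is an $mpM$-algebra and $t$ is an automorphism of $A$ with $t^k(x)=x$ for all $x\in A$; it is regarded as an algebra with the operations $\wedge,\vee,\sim,{}^*,t,0,1$. Let $T_3=\{0,a,1\}$ be the $mpM$-algebra on the chain $0<a<1$ with $\sim a=a$, $a^*=0$, and let $T_4=\{0,a,b,1\}$ be the $mpM$-algebra on the four-element lattice with $a,b$ incomparable and $\sim a=a$, $\sim b=b$, $a^*=b$, $b^*=a$; in both, $\sim 0=0^*=1$ and $\sim 1=1^*=0$. For $i=3,4$ let $T_{i,k}=T_i^k$ with the pointwise operations and $t(x_1,\dots,x_k)=(x_k,x_1,\dots,x_{k-1})$.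 \textbf{Theorem.} Let $k\ge 1$ be an integer. The class of ${\cal C}_k$-algebras is a variety (closed under homomorphic images, subalgebras and direct products), which is finitely generated, i.e.\ it is the least variety containing some finite set of finite algebras, and locally finite, i.e.\ every finitely generated subalgebra of a ${\cal C}_k$-algebra is finite. Moreover, an algebra (of this type) is a simple ${\cal C}_k$-algebra if and only if it is isomorphic to a subalgebra of $(T_{3,k},t)$ or of $(T_{4,k},t)$ (these algebras themselves included), where an algebra is simple if it has more than one element and its only congruences are the identity and the total relation. -/

import Mathlib

universe u v

/-! ### Algebras of the type of modal pseudocomplemented De Morgan algebras -/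

/-- The operations of an `mpM`-algebra: `∧`, `∨`, `∼`, `*`, `0`, `1`. No laws are imposed. -/
class MpMOps (A : Type u) where
  meet : A → A → A
  join : A → A → A
  neg : A → A
  star : A → A
  zero : A
  one : A

/-- The operations of a `C_k`-algebra: those of an `mpM`-algebra and a further unary `t`.
No laws are imposed. -/
class CkOps (A : Type u) extends MpMOps A where
  t : A → A

open MpMOps CkOps

/-- The order of a lattice given by its operations: `x ≤ y` means `x ∧ y = x`. -/
def MpMOps.Le {A : Type u} [MpMOps A] (x y : A) : Prop := meet x y = x

/-- Modal pseudocomplemented De Morgan algebras. -/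
structure IsMpMAlgebra (A : Type u) [MpMOps A] : Prop where
  /- bounded distributive lattice -/
  meet_comm : ∀ x y : A, meet x y = meet y x
  join_comm : ∀ x y : A, join x y = join y x
  meet_assoc : ∀ x y z : A, meet (meet x y) z = meet x (meet y z)
  join_assoc : ∀ x y z : A, join (join x y) z = join x (join y z)
  meet_join_self : ∀ x y : A, meet x (join x y) = x
  join_meet_self : ∀ x y : A, join x (meet x y) = x
  meet_join_distrib : ∀ x y z : A, meet x (join y z) = join (meet x y) (meet x z)
  zero_le : ∀ x : A, Le zero x
  le_one : ∀ x : A, Le x one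
  /- De Morgan negation -/
  neg_neg : ∀ x : A, neg (neg x) = x
  neg_meet : ∀ x y : A, neg (meet x y) = join (neg x) (neg y)
  /- `star a` is the pseudocomplement of `a` -/
  star_iff : ∀ a x : A, meet a x = zero ↔ Le x (star a)
  /- the modal law `x ∨ ∼x ≤ x ∨ x*` -/
  tm : ∀ x : A, Le (join x (neg x)) (join x (star x))

/-- Homomorphisms of the type of `mpM`-algebras. -/
structure IsMpMHom {A : Type u} {B : Type v} [MpMOps A] [MpMOps B] (f : A → B) : Prop where
  map_meet : ∀ x y, f (meet x y) = meet (f x) (f y)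
  map_join : ∀ x y, f (join x y) = join (f x) (f y)
  map_neg : ∀ x, f (neg x) = neg (f x)
  map_star : ∀ x, f (star x) = star (f x)
  map_zero : f zero = zero
  map_one : f one = one

/-- `C_k`-algebras: `mpM`-algebras with an automorphism `t` such that `t^k = id`. -/
structure IsCkAlgebra (k : ℕ) (A : Type u) [CkOps A] : Prop where
  isMpM : IsMpMAlgebra A
  t_hom : IsMpMHom (t : A → A)
  t_bijective : Function.Bijective (t : A → A)
  t_iterate : ∀ x : A, t^[k] x = x

/-! ### Homomorphisms, subalgebras, products, congruences -/

/-- Homomorphisms of the type of `C_k`-algebras. -/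
structure IsCkHom {A : Type u} {B : Type v} [CkOps A] [CkOps B] (f : A → B) : Prop
    extends IsMpMHom f where
  map_t : ∀ x, f (t x) = t (f x)

/-- `A` and `B` are isomorphic. -/
def CkIsomorphic (A : Type u) (B : Type v) [CkOps A] [CkOps B] : Prop :=
  ∃ f : A → B, IsCkHom f ∧ Function.Bijective f

/-- Subalgebras: subsets closed under all operations (constants included). -/
structure CkSubalgebra (A : Type u) [CkOps A] where
  carrier : Set A
  meet_mem : ∀ {x y}, x ∈ carrier → y ∈ carrier → meet x y ∈ carrier
  join_mem : ∀ {x y}, x ∈ carrier → y ∈ carrier → join x y ∈ carrier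
  neg_mem : ∀ {x}, x ∈ carrier → neg x ∈ carrier
  star_mem : ∀ {x}, x ∈ carrier → star x ∈ carrier
  t_mem : ∀ {x}, x ∈ carrier → t x ∈ carrier
  zero_mem : zero ∈ carrier
  one_mem : one ∈ carrier

/-- A subalgebra with the restricted operations. -/
instance CkSubalgebra.instCkOps {A : Type u} [CkOps A] (S : CkSubalgebra A) :
    CkOps S.carrier where
  meet x y := ⟨meet x.1 y.1, S.meet_mem x.2 y.2⟩
  join x y := ⟨join x.1 y.1, S.join_mem x.2 y.2⟩
  neg x := ⟨neg x.1, S.neg_mem x.2⟩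
  star x := ⟨star x.1, S.star_mem x.2⟩
  zero := ⟨zero, S.zero_mem⟩
  one := ⟨one, S.one_mem⟩
  t x := ⟨t x.1, S.t_mem x.2⟩

/-- The universe of the subalgebra generated by a set. -/
def ckGenerated {A : Type u} [CkOps A] (X : Set A) : Set A :=
  {a | ∀ S : CkSubalgebra A, X ⊆ S.carrier → a ∈ S.carrier}

/-- Direct products, with pointwise operations. -/
instance piCkOps {ι : Type v} (F : ι → Type u) [∀ i, CkOps (F i)] : CkOps (∀ i, F i) where
  meet x y := fun i => meet (x i) (y i)
  join x y := fun i => join (x i) (y i)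
  neg x := fun i => neg (x i)
  star x := fun i => star (x i)
  zero := fun _ => zero
  one := fun _ => one
  t x := fun i => t (x i)

/-- Congruences: equivalence relations compatible with all operations. -/
structure IsCkCongruence {A : Type u} [CkOps A] (θ : Setoid A) : Prop where
  meet_congr : ∀ {x x' y y'}, θ x x' → θ y y' → θ (meet x y) (meet x' y')
  join_congr : ∀ {x x' y y'}, θ x x' → θ y y' → θ (join x y) (join x' y')
  neg_congr : ∀ {x x'}, θ x x' → θ (neg x) (neg x')
  star_congr : ∀ {x x'}, θ x x' → θ (star x) (star x')
  t_congr : ∀ {x x'}, θ x x' → θ (t x) (t x')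

/-- Simple algebras: nontrivial, and the only congruences are the identity and the total
relation. -/
def IsCkSimple (A : Type u) [CkOps A] : Prop :=
  Nontrivial A ∧ ∀ θ : Setoid A, IsCkCongruence θ → θ = ⊥ ∨ θ = ⊤

/-! ### Classes of algebras -/

/-- Algebras of the type of `C_k`-algebras (no laws). -/
structure CkTypeAlg where
  carrier : Type u
  [ops : CkOps carrier]

attribute [instance] CkTypeAlg.ops

/-- A variety: a class of algebras closed under homomorphic images, subalgebras and direct
products. -/
structure IsVariety (V : Set CkTypeAlg.{u}) : Prop where
  image_mem : ∀ A B : CkTypeAlg.{u}, A ∈ V →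
    (∃ f : A.carrier → B.carrier, IsCkHom f ∧ Function.Surjective f) → B ∈ V
  sub_mem : ∀ A : CkTypeAlg.{u}, A ∈ V → ∀ S : CkSubalgebra A.carrier,
    CkTypeAlg.mk S.carrier ∈ V
  prod_mem : ∀ (ι : Type u) (F : ι → CkTypeAlg.{u}), (∀ i, F i ∈ V) →
    CkTypeAlg.mk (∀ i, (F i).carrier) ∈ V

/-- The variety generated by a class `K`: the least variety containing `K`. -/
def generatedVariety (K : Set CkTypeAlg.{u}) : Set CkTypeAlg.{u} :=
  {A | ∀ V : Set CkTypeAlg.{u}, IsVariety V → K ⊆ V → A ∈ V}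

/-- A class is a finitely generated variety if it is the variety generated by a finite set of
finite algebras. -/
def IsFinitelyGeneratedVariety (V : Set CkTypeAlg.{u}) : Prop :=
  ∃ K : Set CkTypeAlg.{u}, K.Finite ∧ (∀ A ∈ K, Finite A.carrier) ∧ V = generatedVariety K

/-- A class is locally finite if in each of its members every finitely generated subalgebra
is finite. -/
def IsLocallyFiniteClass (V : Set CkTypeAlg.{u}) : Prop :=
  ∀ A ∈ V, ∀ X : Set A.carrier, X.Finite → (ckGenerated X).Finite

/-- The class of all `C_k`-algebras. -/
def ckAlgebras (k : ℕ) : Set CkTypeAlg.{u} := {A | IsCkAlgebra k A.carrier}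

/-! ### The algebras `T_{3,k}` and `T_{4,k}` -/

/-- The chain `0 < a < 1`. -/
inductive T3 : Type
  | zero | a | one

/-- The `mpM`-algebra `T_3`. -/
instance T3.instMpMOps : MpMOps T3 where
  meet
    | .zero, _ => .zero
    | .one, y => y
    | .a, .zero => .zero
    | .a, .a => .a
    | .a, .one => .a
  join
    | .zero, y => y
    | .one, _ => .one
    | .a, .zero => .a
    | .a, .a => .a
    | .a, .one => .one
  neg
    | .zero => .one
    | .a => .a
    | .one => .zero
  star
    | .zero => .one
    | .a => .zero
    | .one => .zero
  zero := .zero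
  one := .one

/-- The four-element lattice with incomparable `a`, `b` between `0` and `1`. -/
inductive T4 : Type
  | zero | a | b | one

/-- The `mpM`-algebra `T_4`. -/
instance T4.instMpMOps : MpMOps T4 where
  meet
    | .zero, _ => .zero
    | .one, y => y
    | .a, .zero => .zero
    | .a, .a => .a
    | .a, .b => .zero
    | .a, .one => .a
    | .b, .zero => .zero
    | .b, .a => .zero
    | .b, .b => .b
    | .b, .one => .b
  join
    | .zero, y => y
    | .one, _ => .one
    | .a, .zero => .a
    | .a, .a => .a
    | .a, .b => .one
    | .a, .one => .one
    | .b, .zero => .b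
    | .b, .a => .one
    | .b, .b => .b
    | .b, .one => .one
  neg
    | .zero => .one
    | .a => .a
    | .b => .b
    | .one => .zero
  star
    | .zero => .one
    | .a => .b
    | .b => .a
    | .one => .zero
  zero := .zero
  one := .one

/-- The set `T^k` of sequences of length `k`. -/
def CyclicPower (T : Type u) (k : ℕ) : Type u := Fin k → T

/-- `T^k` with pointwise operations and the cyclic shift
`t (x₁, …, x_k) = (x_k, x₁, …, x_{k-1})`. -/
instance CyclicPower.instCkOps (T : Type u) [MpMOps T] (k : ℕ) : CkOps (CyclicPower T k) where
  meet x y := fun i => meet (x i) (y i)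
  join x y := fun i => join (x i) (y i)
  neg x := fun i => neg (x i)
  star x := fun i => star (x i)
  zero := fun _ => zero
  one := fun _ => one
  t x := fun i => x ((finRotate k).symm i)

/-! Everything rests on one separation fact, `IsCkAlgebra.exists_separating_hom`: homomorphisms to
`T_{3,k}` and `T_{4,k}` separate the points of a `C_k`-algebra. Given a ≠ b, take a prime filter P
containing exactly one of them, and let φ(P) = {x | ∼x ∉ P}. Record for each x whether x ∈ P and
whether ∼x ∈ P. The modal law makes this pair of bits determine the pair for x*. If P and φ(P) are
comparable, at most three pairs occur and the record is a homomorphism to `T_3`; otherwise it is one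
to `T_4`. Composing with the powers of t turns it into a homomorphism to the cyclic power.

Finite generation follows, since every `C_k`-algebra embeds in a product of copies of two finite
algebras. So does local finiteness: a homomorphism to a finite algebra is determined on a generated
subalgebra by its values on the generators, so finitely many coordinates suffice. A simple algebra
embeds through any single separating homomorphism.

Conversely, `eqTerm` computes equality on both `T_3` and `T_4`. Its meet over the t-orbit is 1 on
equal tuples and 0 on tuples that differ anywhere, so a congruence identifying two distinct elements
identifies 0 and 1.

That the class is a variety needs an equational form of the pseudocomplement law,
`star_iff_of_identities`. -/

/-! ### Elementary facts on `mpM`-algebras -/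

namespace IsMpMAlgebra

variable {A : Type u} [MpMOps A]

/-- The distributive lattice underlying an `mpM`-algebra. -/
@[reducible]
def distribLattice (hA : IsMpMAlgebra A) : DistribLattice A :=
  letI : Max A := ⟨join⟩
  letI : Min A := ⟨meet⟩
  letI : Lattice A := Lattice.mk' hA.join_comm hA.join_assoc hA.meet_comm hA.meet_assoc
    hA.join_meet_self hA.meet_join_self
  DistribLattice.ofInfSupLe fun x y z => (hA.meet_join_distrib x y z).le

theorem meet_self (hA : IsMpMAlgebra A) (x : A) : meet x x = x := by
  have h := hA.meet_join_self x (meet x x)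
  rwa [hA.join_meet_self] at h

theorem meet_zero (hA : IsMpMAlgebra A) (x : A) : meet x zero = zero := by
  rw [hA.meet_comm]; exact hA.zero_le x

theorem one_meet (hA : IsMpMAlgebra A) (x : A) : meet one x = x := by
  rw [hA.meet_comm]; exact hA.le_one x

theorem neg_join (hA : IsMpMAlgebra A) (x y : A) : neg (join x y) = meet (neg x) (neg y) := by
  rw [← hA.neg_neg (meet (neg x) (neg y)), hA.neg_meet, hA.neg_neg, hA.neg_neg]

theorem neg_zero (hA : IsMpMAlgebra A) : neg (zero : A) = one := by
  have h : join (neg zero) one = neg (zero : A) := by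
    conv_lhs => rw [← hA.neg_neg one, ← hA.neg_meet]
    rw [hA.zero_le]
  rw [← h, hA.join_comm, ← hA.one_meet (neg zero), hA.join_meet_self]

theorem neg_one (hA : IsMpMAlgebra A) : neg (one : A) = zero := by
  rw [← hA.neg_zero, hA.neg_neg]

theorem meet_star_self (hA : IsMpMAlgebra A) (x : A) : meet x (star x) = zero :=
  (hA.star_iff x (star x)).2 (hA.meet_self _)

theorem star_zero (hA : IsMpMAlgebra A) : star (zero : A) = one := by
  rw [← hA.one_meet (star zero)]
  exact (hA.star_iff zero one).1 (hA.zero_le one)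

/-- The element x ∧ (x ∧ y)* is disjoint from y, and x ∧ y* is disjoint from x ∧ y. Besides giving
an equational axiom for `star`, this identity lets a pseudocomplement be computed below a chosen
element of a filter. -/
theorem meet_star_meet (hA : IsMpMAlgebra A) (x y : A) :
    meet x (star (meet x y)) = meet x (star y) := by
  have h₁ : Le (meet x (star (meet x y))) (star y) := by
    rw [← hA.star_iff, ← hA.meet_assoc, hA.meet_comm y x, hA.meet_star_self]
  have h₂ : Le (meet x (star y)) (star (meet x y)) := by
    rw [← hA.star_iff, hA.meet_comm x (star y), hA.meet_assoc, ← hA.meet_assoc y,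
      hA.meet_star_self, hA.zero_le, hA.meet_zero]
  unfold Le at h₁ h₂
  -- Both sides of the goal equal x ∧ (x ∧ y)* ∧ y*.
  rw [hA.meet_assoc] at h₁ h₂
  rw [← h₁, hA.meet_comm (star (meet x y)), h₂]

/-- The pseudocomplement law follows from the identities `x ∧ x* = 0`, `0* = 1` and
`x ∧ (x ∧ y)* = x ∧ y*`. -/
theorem star_iff_of_identities
    (meet_comm : ∀ x y : A, meet x y = meet y x)
    (meet_assoc : ∀ x y z : A, meet (meet x y) z = meet x (meet y z))
    (zero_le : ∀ x : A, Le zero x) (le_one : ∀ x : A, Le x one)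
    (meet_star_self : ∀ x : A, meet x (star x) = zero) (star_zero : star (zero : A) = one)
    (meet_star_meet : ∀ x y : A, meet x (star (meet x y)) = meet x (star y)) (a x : A) :
    meet a x = zero ↔ Le x (star a) := by
  constructor
  · intro h
    unfold Le
    -- x ∧ a* = x ∧ (x ∧ a)* = x ∧ 0* = x ∧ 1.
    rw [← meet_star_meet, meet_comm x a, h, star_zero]
    exact le_one x
  · intro h
    rw [← h, meet_comm x, ← meet_assoc, meet_star_self]
    exact zero_le x

end IsMpMAlgebra

/-! ### Closure of the class of `C_k`-algebras -/

theorem IsCkHom.iterate_t {A : Type u} {B : Type v} [CkOps A] [CkOps B] {f : A → B}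
    (hf : IsCkHom f) (n : ℕ) (x : A) : f (t^[n] x) = t^[n] (f x) :=
  (Function.Semiconj.iterate_right (f := f) (ga := t) (gb := t) hf.map_t n) x

/-- The inverse of t is t^(k-1), so bijectivity is a consequence of the identity t^k = id and need
not be transferred separately. -/
theorem t_bijective_of_iterate {A : Type u} [CkOps A] {k : ℕ} (hk : 1 ≤ k)
    (h : ∀ x : A, t^[k] x = x) : Function.Bijective (t : A → A) := by
  obtain ⟨n, rfl⟩ := Nat.exists_eq_add_of_le' hk
  refine Function.bijective_iff_has_inverse.2 ⟨t^[n], fun x => ?_, fun x => ?_⟩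
  · exact (Function.iterate_succ_apply t n x).symm.trans (h x)
  · exact (Function.iterate_succ_apply' t n x).symm.trans (h x)

theorem IsMpMAlgebra.of_injective {A : Type u} {B : Type v} [MpMOps A] [MpMOps B] {f : A → B}
    (hB : IsMpMAlgebra B) (hf : IsMpMHom f) (hinj : Function.Injective f) : IsMpMAlgebra A where
  meet_comm x y := hinj (by simp only [hf.map_meet, hB.meet_comm (f x)])
  join_comm x y := hinj (by simp only [hf.map_join, hB.join_comm (f x)])
  meet_assoc x y z := hinj (by simp only [hf.map_meet, hB.meet_assoc])
  join_assoc x y z := hinj (by simp only [hf.map_join, hB.join_assoc])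
  meet_join_self x y := hinj (by simp only [hf.map_meet, hf.map_join, hB.meet_join_self])
  join_meet_self x y := hinj (by simp only [hf.map_meet, hf.map_join, hB.join_meet_self])
  meet_join_distrib x y z := hinj (by
    simp only [hf.map_meet, hf.map_join, hB.meet_join_distrib])
  zero_le x := hinj (by rw [hf.map_meet, hf.map_zero]; exact hB.zero_le _)
  le_one x := hinj (by rw [hf.map_meet, hf.map_one]; exact hB.le_one _)
  neg_neg x := hinj (by simp only [hf.map_neg, hB.neg_neg])
  neg_meet x y := hinj (by simp only [hf.map_neg, hf.map_meet, hf.map_join, hB.neg_meet])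
  star_iff a x := by
    have h := hB.star_iff (f a) (f x)
    unfold Le at h ⊢
    rwa [← hf.map_star, ← hf.map_meet, ← hf.map_meet, ← hf.map_zero, hinj.eq_iff,
      hinj.eq_iff] at h
  tm x := hinj (by
    simp only [hf.map_neg, hf.map_meet, hf.map_join, hf.map_star]; exact hB.tm (f x))

theorem IsCkAlgebra.of_injective {k : ℕ} (hk : 1 ≤ k) {A : Type u} {B : Type v} [CkOps A]
    [CkOps B] {f : A → B} (hB : IsCkAlgebra k B) (hf : IsCkHom f)
    (hinj : Function.Injective f) : IsCkAlgebra k A := by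
  have ht : ∀ x : A, t^[k] x = x := fun x => hinj (by rw [hf.iterate_t, hB.t_iterate])
  have h := hB.t_hom
  exact {
    isMpM := hB.isMpM.of_injective hf.toIsMpMHom hinj
    t_hom := {
      map_meet := fun x y => hinj (by simp only [hf.map_t, hf.map_meet, h.map_meet])
      map_join := fun x y => hinj (by simp only [hf.map_t, hf.map_join, h.map_join])
      map_neg := fun x => hinj (by simp only [hf.map_t, hf.map_neg, h.map_neg])
      map_star := fun x => hinj (by simp only [hf.map_t, hf.map_star, h.map_star])
      map_zero := hinj (by simp only [hf.map_t, hf.map_zero, h.map_zero])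
      map_one := hinj (by simp only [hf.map_t, hf.map_one, h.map_one]) }
    t_bijective := t_bijective_of_iterate hk ht
    t_iterate := ht }

/-- Identities pass to images. The pseudocomplement law is a biconditional, so it is first replaced
by three identities and recovered in B from them. -/
theorem IsMpMAlgebra.of_surjective {A : Type u} {B : Type v} [MpMOps A] [MpMOps B] {f : A → B}
    (hA : IsMpMAlgebra A) (hf : IsMpMHom f) (hsurj : Function.Surjective f) :
    IsMpMAlgebra B := by
  have meet_comm : ∀ x y : B, meet x y = meet y x :=
    hsurj.forall₂.2 fun x y => by rw [← hf.map_meet, hA.meet_comm, hf.map_meet]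
  have meet_assoc : ∀ x y z : B, meet (meet x y) z = meet x (meet y z) :=
    hsurj.forall₃.2 fun x y z => by simp only [← hf.map_meet, hA.meet_assoc]
  have zero_le : ∀ x : B, Le zero x :=
    hsurj.forall.2 fun x => by
      unfold Le; rw [← hf.map_zero, ← hf.map_meet, hA.zero_le]
  have le_one : ∀ x : B, Le x one :=
    hsurj.forall.2 fun x => by
      unfold Le; rw [← hf.map_one, ← hf.map_meet, hA.le_one]
  exact {
    meet_comm := meet_comm
    join_comm := hsurj.forall₂.2 fun x y => by rw [← hf.map_join, hA.join_comm, hf.map_join]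
    meet_assoc := meet_assoc
    join_assoc := hsurj.forall₃.2 fun x y z => by simp only [← hf.map_join, hA.join_assoc]
    meet_join_self := hsurj.forall₂.2 fun x y => by
      simp only [← hf.map_meet, ← hf.map_join, hA.meet_join_self]
    join_meet_self := hsurj.forall₂.2 fun x y => by
      simp only [← hf.map_meet, ← hf.map_join, hA.join_meet_self]
    meet_join_distrib := hsurj.forall₃.2 fun x y z => by
      simp only [← hf.map_meet, ← hf.map_join, hA.meet_join_distrib]
    zero_le := zero_le
    le_one := le_one
    neg_neg := hsurj.forall.2 fun x => by simp only [← hf.map_neg, hA.neg_neg]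
    neg_meet := hsurj.forall₂.2 fun x y => by
      simp only [← hf.map_neg, ← hf.map_meet, ← hf.map_join, hA.neg_meet]
    star_iff := IsMpMAlgebra.star_iff_of_identities meet_comm meet_assoc zero_le le_one
      (hsurj.forall.2 fun x => by
        rw [← hf.map_star, ← hf.map_meet, hA.meet_star_self, hf.map_zero])
      (by rw [← hf.map_zero, ← hf.map_star, hA.star_zero, hf.map_one])
      (hsurj.forall₂.2 fun x y => by
        simp only [← hf.map_star, ← hf.map_meet, hA.meet_star_meet])
    tm := hsurj.forall.2 fun x => by
      unfold Le
      simp only [← hf.map_star, ← hf.map_neg, ← hf.map_meet, ← hf.map_join]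
      exact congrArg f (hA.tm x) }

theorem IsCkAlgebra.of_surjective {k : ℕ} (hk : 1 ≤ k) {A : Type u} {B : Type v} [CkOps A]
    [CkOps B] {f : A → B} (hA : IsCkAlgebra k A) (hf : IsCkHom f)
    (hsurj : Function.Surjective f) : IsCkAlgebra k B := by
  have ht : ∀ x : B, t^[k] x = x :=
    hsurj.forall.2 fun x => by rw [← hf.iterate_t, hA.t_iterate]
  have h := hA.t_hom
  exact {
    isMpM := hA.isMpM.of_surjective hf.toIsMpMHom hsurj
    t_hom := {
      map_meet := hsurj.forall₂.2 fun x y => by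
        simp only [← hf.map_t, ← hf.map_meet, h.map_meet]
      map_join := hsurj.forall₂.2 fun x y => by
        simp only [← hf.map_t, ← hf.map_join, h.map_join]
      map_neg := hsurj.forall.2 fun x => by simp only [← hf.map_t, ← hf.map_neg, h.map_neg]
      map_star := hsurj.forall.2 fun x => by simp only [← hf.map_t, ← hf.map_star, h.map_star]
      map_zero := by rw [← hf.map_zero, ← hf.map_t, h.map_zero]
      map_one := by rw [← hf.map_one, ← hf.map_t, h.map_one] }
    t_bijective := t_bijective_of_iterate hk ht
    t_iterate := ht }

theorem IsMpMAlgebra.pi {ι : Type v} {F : ι → Type u} [∀ i, CkOps (F i)]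
    (hF : ∀ i, IsMpMAlgebra (F i)) : IsMpMAlgebra (∀ i, F i) where
  meet_comm _ _ := funext fun i => (hF i).meet_comm _ _
  join_comm _ _ := funext fun i => (hF i).join_comm _ _
  meet_assoc _ _ _ := funext fun i => (hF i).meet_assoc _ _ _
  join_assoc _ _ _ := funext fun i => (hF i).join_assoc _ _ _
  meet_join_self _ _ := funext fun i => (hF i).meet_join_self _ _
  join_meet_self _ _ := funext fun i => (hF i).join_meet_self _ _
  meet_join_distrib _ _ _ := funext fun i => (hF i).meet_join_distrib _ _ _
  zero_le _ := funext fun i => (hF i).zero_le _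
  le_one _ := funext fun i => (hF i).le_one _
  neg_neg _ := funext fun i => (hF i).neg_neg _
  neg_meet _ _ := funext fun i => (hF i).neg_meet _ _
  star_iff _ _ := ⟨fun h => funext fun i => ((hF i).star_iff _ _).1 (congrFun h i),
    fun h => funext fun i => ((hF i).star_iff _ _).2 (congrFun h i)⟩
  tm _ := funext fun i => (hF i).tm _

theorem isCkHom_eval {ι : Type v} (F : ι → Type u) [∀ i, CkOps (F i)] (i : ι) :
    IsCkHom (fun x : ∀ i, F i => x i) where
  map_meet _ _ := rfl
  map_join _ _ := rfl
  map_neg _ := rfl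
  map_star _ := rfl
  map_zero := rfl
  map_one := rfl
  map_t _ := rfl

theorem IsCkAlgebra.pi {k : ℕ} (hk : 1 ≤ k) {ι : Type v} {F : ι → Type u}
    [∀ i, CkOps (F i)] (hF : ∀ i, IsCkAlgebra k (F i)) : IsCkAlgebra k (∀ i, F i) := by
  have ht : ∀ x : ∀ i, F i, t^[k] x = x := fun x => funext fun i => by
    rw [(isCkHom_eval F i).iterate_t, (hF i).t_iterate]
  exact {
    isMpM := IsMpMAlgebra.pi fun i => (hF i).isMpM
    t_hom := {
      map_meet := fun x y => funext fun i => (hF i).t_hom.map_meet _ _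
      map_join := fun x y => funext fun i => (hF i).t_hom.map_join _ _
      map_neg := fun x => funext fun i => (hF i).t_hom.map_neg _
      map_star := fun x => funext fun i => (hF i).t_hom.map_star _
      map_zero := funext fun i => (hF i).t_hom.map_zero
      map_one := funext fun i => (hF i).t_hom.map_one }
    t_bijective := t_bijective_of_iterate hk ht
    t_iterate := ht }

theorem CkSubalgebra.isCkHom_val {A : Type u} [CkOps A] (S : CkSubalgebra A) :
    IsCkHom (Subtype.val : S.carrier → A) where
  map_meet _ _ := rfl
  map_join _ _ := rfl
  map_neg _ := rfl
  map_star _ := rfl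
  map_zero := rfl
  map_one := rfl
  map_t _ := rfl

/-- For `k ≥ 1` the class of `C_k`-algebras is a variety. -/
theorem isVariety_ckAlgebras {k : ℕ} (hk : 1 ≤ k) : IsVariety (ckAlgebras.{u} k) where
  image_mem _ _ hA := fun ⟨_, hf, hsurj⟩ => IsCkAlgebra.of_surjective hk hA hf hsurj
  sub_mem _ hA S := IsCkAlgebra.of_injective hk hA S.isCkHom_val Subtype.val_injective
  prod_mem _ _ hF := IsCkAlgebra.pi hk hF

/-! ### Homomorphisms and subalgebras -/

theorem IsCkHom.comp {A B C : Type*} [CkOps A] [CkOps B] [CkOps C] {g : B → C} {f : A → B}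
    (hg : IsCkHom g) (hf : IsCkHom f) : IsCkHom (g ∘ f) where
  map_meet x y := by simp only [Function.comp_apply, hf.map_meet, hg.map_meet]
  map_join x y := by simp only [Function.comp_apply, hf.map_join, hg.map_join]
  map_neg x := by simp only [Function.comp_apply, hf.map_neg, hg.map_neg]
  map_star x := by simp only [Function.comp_apply, hf.map_star, hg.map_star]
  map_zero := by simp only [Function.comp_apply, hf.map_zero, hg.map_zero]
  map_one := by simp only [Function.comp_apply, hf.map_one, hg.map_one]
  map_t x := by simp only [Function.comp_apply, hf.map_t, hg.map_t]

/-- The range of a homomorphism. -/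
def IsCkHom.range {A : Type u} {B : Type v} [CkOps A] [CkOps B] {f : A → B}
    (hf : IsCkHom f) : CkSubalgebra B where
  carrier := Set.range f
  meet_mem := by rintro _ _ ⟨x, rfl⟩ ⟨y, rfl⟩; exact ⟨_, hf.map_meet x y⟩
  join_mem := by rintro _ _ ⟨x, rfl⟩ ⟨y, rfl⟩; exact ⟨_, hf.map_join x y⟩
  neg_mem := by rintro _ ⟨x, rfl⟩; exact ⟨_, hf.map_neg x⟩
  star_mem := by rintro _ ⟨x, rfl⟩; exact ⟨_, hf.map_star x⟩
  t_mem := by rintro _ ⟨x, rfl⟩; exact ⟨_, hf.map_t x⟩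
  zero_mem := ⟨_, hf.map_zero⟩
  one_mem := ⟨_, hf.map_one⟩

/-- The set on which two homomorphisms agree. -/
def IsCkHom.equalizer {A : Type u} {B : Type v} [CkOps A] [CkOps B] {f g : A → B}
    (hf : IsCkHom f) (hg : IsCkHom g) : CkSubalgebra A where
  carrier := {x | f x = g x}
  meet_mem {x y} hx hy := by
    rw [Set.mem_ofPred_eq] at *; rw [hf.map_meet, hg.map_meet, hx, hy]
  join_mem {x y} hx hy := by
    rw [Set.mem_ofPred_eq] at *; rw [hf.map_join, hg.map_join, hx, hy]
  neg_mem {x} hx := by rw [Set.mem_ofPred_eq] at *; rw [hf.map_neg, hg.map_neg, hx]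
  star_mem {x} hx := by rw [Set.mem_ofPred_eq] at *; rw [hf.map_star, hg.map_star, hx]
  t_mem {x} hx := by rw [Set.mem_ofPred_eq] at *; rw [hf.map_t, hg.map_t, hx]
  zero_mem := hf.map_zero.trans hg.map_zero.symm
  one_mem := hf.map_one.trans hg.map_one.symm

theorem IsCkHom.isCkCongruence_ker {A : Type u} {B : Type v} [CkOps A] [CkOps B] {f : A → B}
    (hf : IsCkHom f) : IsCkCongruence (Setoid.ker f) where
  meet_congr {x x' y y'} hx hy := by
    rw [Setoid.ker_def] at *; rw [hf.map_meet, hf.map_meet, hx, hy]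
  join_congr {x x' y y'} hx hy := by
    rw [Setoid.ker_def] at *; rw [hf.map_join, hf.map_join, hx, hy]
  neg_congr {x x'} hx := by rw [Setoid.ker_def] at *; rw [hf.map_neg, hf.map_neg, hx]
  star_congr {x x'} hx := by rw [Setoid.ker_def] at *; rw [hf.map_star, hf.map_star, hx]
  t_congr {x x'} hx := by rw [Setoid.ker_def] at *; rw [hf.map_t, hf.map_t, hx]

theorem IsCkHom.isCkHom_rangeFactorization {A : Type u} {B : Type v} [CkOps A] [CkOps B]
    {f : A → B} (hf : IsCkHom f) :
    IsCkHom (fun x => (⟨f x, x, rfl⟩ : hf.range.carrier)) where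
  map_meet x y := Subtype.ext (hf.map_meet x y)
  map_join x y := Subtype.ext (hf.map_join x y)
  map_neg x := Subtype.ext (hf.map_neg x)
  map_star x := Subtype.ext (hf.map_star x)
  map_zero := Subtype.ext hf.map_zero
  map_one := Subtype.ext hf.map_one
  map_t x := Subtype.ext (hf.map_t x)

theorem IsCkHom.ckIsomorphic_range {A : Type u} {B : Type v} [CkOps A] [CkOps B] {f : A → B}
    (hf : IsCkHom f) (hinj : Function.Injective f) : CkIsomorphic A hf.range.carrier :=
  ⟨_, hf.isCkHom_rangeFactorization, fun _ _ h => hinj (congrArg Subtype.val h),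
    fun ⟨_, x, hx⟩ => ⟨x, Subtype.ext hx⟩⟩

theorem CkIsomorphic.symm {A : Type u} {B : Type v} [CkOps A] [CkOps B]
    (h : CkIsomorphic A B) : CkIsomorphic B A := by
  obtain ⟨f, hf, hbij⟩ := h
  obtain ⟨g, hgf, hfg⟩ := Function.bijective_iff_has_inverse.1 hbij
  refine ⟨g, ?_, Function.bijective_iff_has_inverse.2 ⟨f, hfg, hgf⟩⟩
  exact {
    map_meet := fun x y => hbij.1 (by simp only [hf.map_meet, hfg _])
    map_join := fun x y => hbij.1 (by simp only [hf.map_join, hfg _])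
    map_neg := fun x => hbij.1 (by simp only [hf.map_neg, hfg _])
    map_star := fun x => hbij.1 (by simp only [hf.map_star, hfg _])
    map_zero := hbij.1 (by simp only [hf.map_zero, hfg _])
    map_one := hbij.1 (by simp only [hf.map_one, hfg _])
    map_t := fun x => hbij.1 (by simp only [hf.map_t, hfg _]) }

/-! ### Prime filters and homomorphisms onto subalgebras of `T_3` and `T_4` -/

/-- Prime filters, as predicates. -/
structure IsPrimeFilterPred {A : Type u} [MpMOps A] (p : A → Prop) : Prop where
  meet_iff : ∀ x y, p (meet x y) ↔ p x ∧ p y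
  join_iff : ∀ x y, p (join x y) ↔ p x ∨ p y
  not_zero : ¬ p zero
  one : p one

namespace IsPrimeFilterPred

variable {A : Type u} [MpMOps A] {p : A → Prop}

/-- One of the two elements is not below the other, so a principal filter and a principal ideal are
disjoint. The prime ideal theorem applies, and the complement of the prime ideal is the filter. -/
theorem exists_separating (hA : IsMpMAlgebra A) {a b : A} (hab : a ≠ b) :
    ∃ p : A → Prop, IsPrimeFilterPred p ∧ ¬ (p a ↔ p b) := by
  let _ := hA.distribLattice
  have key : ∀ a b : A, ¬ a ≤ b → ∃ p : A → Prop, IsPrimeFilterPred p ∧ p a ∧ ¬ p b := by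
    intro a b hab
    have hdisj : Disjoint (Order.PFilter.principal a : Set A) (Order.Ideal.principal b : Set A) :=
      Set.disjoint_left.2 fun x hx hx' =>
        hab ((Order.PFilter.mem_principal.1 hx).trans (Order.Ideal.mem_principal.1 hx'))
    obtain ⟨J, hJ, hbJ, haJ⟩ := DistribLattice.prime_ideal_of_disjoint_filter_ideal hdisj
    have ha : a ∉ J := Set.disjoint_left.1 haJ (Order.PFilter.mem_principal.2 le_rfl)
    have hb : b ∈ J := hbJ (Order.Ideal.mem_principal.2 le_rfl)
    refine ⟨fun x => x ∉ J, ⟨fun x y => ?_, fun x y => ?_, ?_, ?_⟩, ha, fun h => h hb⟩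
    · rw [← not_or, not_iff_not]
      exact ⟨hJ.mem_or_mem, fun h => h.elim (J.lower (inf_le_left : x ⊓ y ≤ x))
        (J.lower (inf_le_right : x ⊓ y ≤ y))⟩
    · rw [← not_and_or, not_iff_not]
      exact Order.Ideal.sup_mem_iff
    · exact not_not.2 (J.lower (inf_eq_left.1 (hA.zero_le b)) hb)
    · exact fun h => ha (J.lower (inf_eq_left.1 (hA.le_one a)) h)
  by_cases h : a ≤ b
  · obtain ⟨p, hp, hb, ha⟩ := key b a fun h' => hab (le_antisymm h h')
    exact ⟨p, hp, fun h => ha (h.2 hb)⟩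
  · obtain ⟨p, hp, ha, hb⟩ := key a b h
    exact ⟨p, hp, fun h => hb (h.1 ha)⟩

/-- The image of a prime filter under the involution `P ↦ {x | ∼x ∉ P}`. -/
theorem involution (hA : IsMpMAlgebra A) (hp : IsPrimeFilterPred p) :
    IsPrimeFilterPred fun x => ¬ p (neg x) where
  meet_iff x y := by rw [hA.neg_meet, hp.join_iff, not_or]
  join_iff x y := by rw [hA.neg_join, hp.meet_iff, not_and_or]
  not_zero := by rw [hA.neg_zero, not_not]; exact hp.one
  one := by rw [hA.neg_one]; exact hp.not_zero

theorem not_star (hA : IsMpMAlgebra A) (hp : IsPrimeFilterPred p) {x : A} (hx : p x) :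
    ¬ p (star x) := fun h =>
  hp.not_zero (hA.meet_star_self x ▸ (hp.meet_iff _ _).2 ⟨hx, h⟩)

/-- The modal law enters the representation here: x ∨ ∼x ∈ P forces x ∨ x* ∈ P, and P is prime. -/
theorem star (hA : IsMpMAlgebra A) (hp : IsPrimeFilterPred p) {x : A} (hx : ¬ p x)
    (hnx : p (neg x)) : p (MpMOps.star x) := by
  have h : p (meet (join x (neg x)) (join x (MpMOps.star x))) := by
    rw [hA.tm, hp.join_iff]; exact Or.inr hnx
  exact ((hp.join_iff _ _).1 ((hp.meet_iff _ _).1 h).2).resolve_left hx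

/-- A prime filter included in its image under the involution gives a homomorphism to `T_3`. -/
theorem exists_hom_T3 (hA : IsMpMAlgebra A) (hp : IsPrimeFilterPred p)
    (hle : ∀ x, p x → ¬ p (neg x)) :
    ∃ h : A → T3, IsMpMHom h ∧ ∀ x y, h x = h y → (p x ↔ p y) ∧ (p (neg x) ↔ p (neg y)) := by
  classical
  -- The hypothesis `hle` excludes x and ∼x both lying in P, so three of the four combinations
  -- remain.
  let h : A → T3 := fun x => if p x then .one else if p (neg x) then .zero else .a
  have h_one : ∀ {x}, p x → h x = .one := fun hx => if_pos hx
  have h_zero : ∀ {x}, p (neg x) → h x = .zero := fun {x} hx => by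
    simp only [h, hx, if_true, if_neg fun hx' => hle x hx' hx]
  have h_a : ∀ {x}, ¬ p x → ¬ p (neg x) → h x = .a := fun hx hnx => by
    simp only [h, hx, hnx, if_false]
  have cases : ∀ x, (p x ∧ ¬ p (neg x) ∧ h x = .one) ∨ (¬ p x ∧ p (neg x) ∧ h x = .zero) ∨
      (¬ p x ∧ ¬ p (neg x) ∧ h x = .a) := by
    intro x
    by_cases hx : p x
    · exact Or.inl ⟨hx, hle x hx, h_one hx⟩
    · by_cases hnx : p (neg x)
      · exact Or.inr (Or.inl ⟨hx, hnx, h_zero hnx⟩)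
      · exact Or.inr (Or.inr ⟨hx, hnx, h_a hx hnx⟩)
  have hq := hp.involution hA
  refine ⟨h, ⟨fun x y => ?_, fun x y => ?_, fun x => ?_, fun x => ?_, ?_, ?_⟩, fun x y hxy => ?_⟩
  · have h₁ := hp.meet_iff x y
    have h₂ := hp.join_iff (neg x) (neg y)
    rw [← hA.neg_meet] at h₂
    rcases cases x with ⟨hx, hx', ex⟩ | ⟨hx, hx', ex⟩ | ⟨hx, hx', ex⟩ <;>
    rcases cases y with ⟨hy, hy', ey⟩ | ⟨hy, hy', ey⟩ | ⟨hy, hy', ey⟩ <;>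
    rcases cases (meet x y) with ⟨hz, hz', ez⟩ | ⟨hz, hz', ez⟩ | ⟨hz, hz', ez⟩ <;>
    first
    | (rw [ex, ey, ez]; rfl)
    | (exfalso; tauto)
  · have h₁ := hp.join_iff x y
    have h₂ := hp.meet_iff (neg x) (neg y)
    rw [← hA.neg_join] at h₂
    rcases cases x with ⟨hx, hx', ex⟩ | ⟨hx, hx', ex⟩ | ⟨hx, hx', ex⟩ <;>
    rcases cases y with ⟨hy, hy', ey⟩ | ⟨hy, hy', ey⟩ | ⟨hy, hy', ey⟩ <;>
    rcases cases (join x y) with ⟨hz, hz', ez⟩ | ⟨hz, hz', ez⟩ | ⟨hz, hz', ez⟩ <;>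
    first
    | (rw [ex, ey, ez]; rfl)
    | (exfalso; tauto)
  · rcases cases x with ⟨hx, hx', ex⟩ | ⟨hx, hx', ex⟩ | ⟨hx, hx', ex⟩
    · rw [ex, h_zero (by rwa [hA.neg_neg])]; rfl
    · rw [ex, h_one hx']; rfl
    · rw [ex, h_a hx' (by rwa [hA.neg_neg])]; rfl
  · have neg_star : ∀ {x}, ¬ p (neg x) → p (neg (MpMOps.star x)) := fun {x} hx =>
      not_not.1 (hq.not_star hA (x := x) hx)
    rcases cases x with ⟨hx, hx', ex⟩ | ⟨hx, hx', ex⟩ | ⟨hx, hx', ex⟩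
    · rw [ex, h_zero (neg_star hx')]; rfl
    · rw [ex, h_one (hp.star hA hx hx')]; rfl
    · rw [ex, h_zero (neg_star hx')]; rfl
  · exact h_zero (by rw [hA.neg_zero]; exact hp.one)
  · exact h_one hp.one
  · rcases cases x with ⟨hx, hx', ex⟩ | ⟨hx, hx', ex⟩ | ⟨hx, hx', ex⟩ <;>
    rcases cases y with ⟨hy, hy', ey⟩ | ⟨hy, hy', ey⟩ | ⟨hy, hy', ey⟩ <;>
    first
    | exact ⟨by tauto, by tauto⟩
    | (rw [ex, ey] at hxy; cases hxy)

/-- A prime filter incomparable with its image under the involution gives a homomorphism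
to `T_4`. -/
theorem exists_hom_T4 (hA : IsMpMAlgebra A) (hp : IsPrimeFilterPred p)
    (hu : ∃ u, p u ∧ p (neg u)) (hv : ∃ v, ¬ p v ∧ ¬ p (neg v)) :
    ∃ h : A → T4, IsMpMHom h ∧ ∀ x y, h x = h y → (p x ↔ p y) := by
  classical
  obtain ⟨u, hu, hnu⟩ := hu
  obtain ⟨v, hv, hnv⟩ := hv
  let h : A → T4 := fun x =>
    if p x then if p (neg x) then .a else .one else if p (neg x) then .zero else .b
  have cases : ∀ x, (p x ∧ p (neg x) ∧ h x = .a) ∨ (p x ∧ ¬ p (neg x) ∧ h x = .one) ∨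
      (¬ p x ∧ p (neg x) ∧ h x = .zero) ∨ (¬ p x ∧ ¬ p (neg x) ∧ h x = .b) := by
    intro x
    by_cases hx : p x <;> by_cases hnx : p (neg x) <;> simp [h, hx, hnx]
  have hq := hp.involution hA
  have p_star : ∀ x, p (MpMOps.star x) ↔ ¬ p x := by
    refine fun x => ⟨fun h hx => hp.not_star hA hx h, fun hx => ?_⟩
    -- Possibly ∼x ∉ P, so the modal law is applied to u ∧ x, whose negation is in P because ∼u is.
    -- Meeting with u ∈ P then removes u by `meet_star_meet`.
    have h₁ : p (MpMOps.star (meet u x)) := hp.star hA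
      (fun h => hx ((hp.meet_iff _ _).1 h).2)
      (by rw [hA.neg_meet, hp.join_iff]; exact Or.inl hnu)
    have h₂ : p (meet u (MpMOps.star (meet u x))) := (hp.meet_iff _ _).2 ⟨hu, h₁⟩
    rw [hA.meet_star_meet] at h₂
    exact ((hp.meet_iff _ _).1 h₂).2
  have p_neg_star : ∀ x, p (neg (MpMOps.star x)) ↔ ¬ p (neg x) := by
    refine fun x => ⟨fun h hx => ?_, fun hx => not_not.1 (hq.not_star hA (x := x) hx)⟩
    -- The same argument for φ(P), with v as the element such that both v and ∼v lie in φ(P).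
    have h₁ : ¬ p (neg (MpMOps.star (meet v x))) := hq.star hA
      (fun h => h (by rw [hA.neg_meet, hp.join_iff]; exact Or.inr hx))
      (by rw [hA.neg_neg]; exact fun h => hv ((hp.meet_iff _ _).1 h).1)
    have h₂ := (hq.meet_iff v (MpMOps.star (meet v x))).2 ⟨hnv, h₁⟩
    rw [hA.meet_star_meet] at h₂
    exact ((hq.meet_iff _ _).1 h₂).2 h
  refine ⟨h, ⟨fun x y => ?_, fun x y => ?_, fun x => ?_, fun x => ?_, ?_, ?_⟩, fun x y hxy => ?_⟩
  · have h₁ := hp.meet_iff x y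
    have h₂ := hp.join_iff (neg x) (neg y)
    rw [← hA.neg_meet] at h₂
    rcases cases x with ⟨hx, hx', ex⟩ | ⟨hx, hx', ex⟩ | ⟨hx, hx', ex⟩ | ⟨hx, hx', ex⟩ <;>
    rcases cases y with ⟨hy, hy', ey⟩ | ⟨hy, hy', ey⟩ | ⟨hy, hy', ey⟩ | ⟨hy, hy', ey⟩ <;>
    rw [ex, ey] <;>
    simp only [h, h₁, h₂, hx, hx', hy, hy'] <;> rfl
  · have h₁ := hp.join_iff x y
    have h₂ := hp.meet_iff (neg x) (neg y)
    rw [← hA.neg_join] at h₂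
    rcases cases x with ⟨hx, hx', ex⟩ | ⟨hx, hx', ex⟩ | ⟨hx, hx', ex⟩ | ⟨hx, hx', ex⟩ <;>
    rcases cases y with ⟨hy, hy', ey⟩ | ⟨hy, hy', ey⟩ | ⟨hy, hy', ey⟩ | ⟨hy, hy', ey⟩ <;>
    rw [ex, ey] <;>
    simp only [h, h₁, h₂, hx, hx', hy, hy'] <;> rfl
  · rcases cases x with ⟨hx, hx', ex⟩ | ⟨hx, hx', ex⟩ | ⟨hx, hx', ex⟩ | ⟨hx, hx', ex⟩ <;>
    rw [ex] <;>
    simp only [h, hA.neg_neg, hx, hx'] <;> rfl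
  · rcases cases x with ⟨hx, hx', ex⟩ | ⟨hx, hx', ex⟩ | ⟨hx, hx', ex⟩ | ⟨hx, hx', ex⟩ <;>
    rw [ex] <;>
    simp only [h, p_star, p_neg_star, hx, hx'] <;> rfl
  · simp only [h, hp.not_zero, hA.neg_zero, hp.one]; rfl
  · simp only [h, hp.not_zero, hA.neg_one, hp.one]; rfl
  · rcases cases x with ⟨hx, hx', ex⟩ | ⟨hx, hx', ex⟩ | ⟨hx, hx', ex⟩ | ⟨hx, hx', ex⟩ <;>
    rcases cases y with ⟨hy, hy', ey⟩ | ⟨hy, hy', ey⟩ | ⟨hy, hy', ey⟩ | ⟨hy, hy', ey⟩ <;>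
    first
    | tauto
    | (rw [ex, ey] at hxy; cases hxy)

end IsPrimeFilterPred

/-- Distinct elements of an `mpM`-algebra are separated by a homomorphism to `T_3` or `T_4`. -/
theorem IsMpMAlgebra.exists_separating_hom {A : Type u} [MpMOps A] (hA : IsMpMAlgebra A)
    {a b : A} (hab : a ≠ b) :
    (∃ h : A → T3, IsMpMHom h ∧ h a ≠ h b) ∨ (∃ h : A → T4, IsMpMHom h ∧ h a ≠ h b) := by
  obtain ⟨p, hp, hpab⟩ := IsPrimeFilterPred.exists_separating hA hab
  by_cases hu : ∃ u, p u ∧ p (neg u)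
  · by_cases hv : ∃ v, ¬ p v ∧ ¬ p (neg v)
    · obtain ⟨h, hh, hsep⟩ := hp.exists_hom_T4 hA hu hv
      exact Or.inr ⟨h, hh, fun e => hpab (hsep a b e)⟩
    -- Here φ(P) ⊆ P = φ(φ(P)), so φ(P) takes the place of P.
    · obtain ⟨h, hh, hsep⟩ := (hp.involution hA).exists_hom_T3 hA (fun x hx hnx => by
        rw [hA.neg_neg] at hnx
        exact hv ⟨x, hnx, hx⟩)
      refine Or.inl ⟨h, hh, fun e => hpab ?_⟩
      -- Membership in P is read off from the negations: ∼x ∈ φ(P) exactly when x ∉ P.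
      have := (hsep a b e).2
      rwa [hA.neg_neg, hA.neg_neg, not_iff_not] at this
  · obtain ⟨h, hh, hsep⟩ := hp.exists_hom_T3 hA (fun x hx hnx => hu ⟨x, hx, hnx⟩)
    exact Or.inl ⟨h, hh, fun e => hpab (hsep a b e).1⟩

/-! ### Cyclic powers -/

theorem isMpMAlgebra_T3 : IsMpMAlgebra T3 where
  meet_comm := by rintro (_ | _ | _) (_ | _ | _) <;> rfl
  join_comm := by rintro (_ | _ | _) (_ | _ | _) <;> rfl
  meet_assoc := by rintro (_ | _ | _) (_ | _ | _) (_ | _ | _) <;> rfl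
  join_assoc := by rintro (_ | _ | _) (_ | _ | _) (_ | _ | _) <;> rfl
  meet_join_self := by rintro (_ | _ | _) (_ | _ | _) <;> rfl
  join_meet_self := by rintro (_ | _ | _) (_ | _ | _) <;> rfl
  meet_join_distrib := by rintro (_ | _ | _) (_ | _ | _) (_ | _ | _) <;> rfl
  zero_le := by rintro (_ | _ | _) <;> rfl
  le_one := by rintro (_ | _ | _) <;> rfl
  neg_neg := by rintro (_ | _ | _) <;> rfl
  neg_meet := by rintro (_ | _ | _) (_ | _ | _) <;> rfl
  star_iff := by
    rintro (_ | _ | _) (_ | _ | _) <;>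
      first
      | exact iff_of_true rfl rfl
      | exact iff_of_false T3.noConfusion T3.noConfusion
  tm := by rintro (_ | _ | _) <;> rfl

theorem isMpMAlgebra_T4 : IsMpMAlgebra T4 where
  meet_comm := by rintro (_ | _ | _ | _) (_ | _ | _ | _) <;> rfl
  join_comm := by rintro (_ | _ | _ | _) (_ | _ | _ | _) <;> rfl
  meet_assoc := by rintro (_ | _ | _ | _) (_ | _ | _ | _) (_ | _ | _ | _) <;> rfl
  join_assoc := by rintro (_ | _ | _ | _) (_ | _ | _ | _) (_ | _ | _ | _) <;> rfl
  meet_join_self := by rintro (_ | _ | _ | _) (_ | _ | _ | _) <;> rfl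
  join_meet_self := by rintro (_ | _ | _ | _) (_ | _ | _ | _) <;> rfl
  meet_join_distrib := by rintro (_ | _ | _ | _) (_ | _ | _ | _) (_ | _ | _ | _) <;> rfl
  zero_le := by rintro (_ | _ | _ | _) <;> rfl
  le_one := by rintro (_ | _ | _ | _) <;> rfl
  neg_neg := by rintro (_ | _ | _ | _) <;> rfl
  neg_meet := by rintro (_ | _ | _ | _) (_ | _ | _ | _) <;> rfl
  star_iff := by
    rintro (_ | _ | _ | _) (_ | _ | _ | _) <;>
      first
      | exact iff_of_true rfl rfl
      | exact iff_of_false T4.noConfusion T4.noConfusion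
  tm := by rintro (_ | _ | _ | _) <;> rfl

/-! ### Finiteness, and powers of the cyclic shift -/

instance : Finite T3 :=
  Finite.of_surjective ![T3.zero, T3.a, T3.one]
    (by rintro (_ | _ | _); exacts [⟨0, rfl⟩, ⟨1, rfl⟩, ⟨2, rfl⟩])

instance : Finite T4 :=
  Finite.of_surjective ![T4.zero, T4.a, T4.b, T4.one]
    (by rintro (_ | _ | _ | _); exacts [⟨0, rfl⟩, ⟨1, rfl⟩, ⟨2, rfl⟩, ⟨3, rfl⟩])

instance CyclicPower.instFinite (T : Type u) [Finite T] (k : ℕ) : Finite (CyclicPower T k) :=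
  inferInstanceAs (Finite (Fin k → T))

/-- `finRotate` is addition of 1 in the cyclic group `Fin (n + 1)`. This yields both that the shift
has period dividing k and that it is transitive on coordinates. -/
theorem finRotate_symm_iterate (n j : ℕ) (i : Fin (n + 1)) :
    (finRotate (n + 1)).symm^[j] i = i - Fin.ofNat (n + 1) j := by
  induction j with
  | zero => simp
  | succ j ih =>
    rw [Function.iterate_succ_apply', ih, Equiv.symm_apply_eq, finRotate_apply]
    have h : Fin.ofNat (n + 1) (j + 1) = Fin.ofNat (n + 1) j + 1 := by
      ext; simp [Fin.val_add]
    rw [h]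
    abel

theorem CyclicPower.t_iterate_apply {T : Type u} [MpMOps T] {k : ℕ} (j : ℕ)
    (x : CyclicPower T k) (i : Fin k) : (t^[j] x) i = x ((finRotate k).symm^[j] i) := by
  induction j generalizing i with
  | zero => rfl
  | succ j ih =>
    rw [Function.iterate_succ_apply', Function.iterate_succ_apply]
    exact ih _

theorem CyclicPower.isCkAlgebra {T : Type u} [MpMOps T] (hT : IsMpMAlgebra T) {k : ℕ}
    (hk : 1 ≤ k) : IsCkAlgebra k (CyclicPower T k) := by
  have ht : ∀ x : CyclicPower T k, t^[k] x = x := fun x => funext fun i => by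
    rw [CyclicPower.t_iterate_apply]
    obtain ⟨n, rfl⟩ := Nat.exists_eq_add_of_le' hk
    rw [finRotate_symm_iterate, Fin.ofNat_self, sub_zero]
  exact {
    isMpM := {
      meet_comm := fun x y => funext fun i => hT.meet_comm _ _
      join_comm := fun x y => funext fun i => hT.join_comm _ _
      meet_assoc := fun x y z => funext fun i => hT.meet_assoc _ _ _
      join_assoc := fun x y z => funext fun i => hT.join_assoc _ _ _
      meet_join_self := fun x y => funext fun i => hT.meet_join_self _ _
      join_meet_self := fun x y => funext fun i => hT.join_meet_self _ _
      meet_join_distrib := fun x y z => funext fun i => hT.meet_join_distrib _ _ _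
      zero_le := fun x => funext fun i => hT.zero_le _
      le_one := fun x => funext fun i => hT.le_one _
      neg_neg := fun x => funext fun i => hT.neg_neg _
      neg_meet := fun x y => funext fun i => hT.neg_meet _ _
      star_iff := fun a x => ⟨fun h => funext fun i => (hT.star_iff _ _).1 (congrFun h i),
        fun h => funext fun i => (hT.star_iff _ _).2 (congrFun h i)⟩
      tm := fun x => funext fun i => hT.tm _ }
    t_hom := {
      map_meet := fun x y => rfl
      map_join := fun x y => rfl
      map_neg := fun x => rfl
      map_star := fun x => rfl
      map_zero := rfl
      map_one := rfl }
    t_bijective := t_bijective_of_iterate hk ht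
    t_iterate := ht }

theorem IsCkAlgebra.t_iterate_hom {k : ℕ} {A : Type u} [CkOps A] (hA : IsCkAlgebra k A)
    (n : ℕ) : IsMpMHom (t^[n] : A → A) := by
  induction n with
  | zero => exact ⟨fun _ _ => rfl, fun _ _ => rfl, fun _ => rfl, fun _ => rfl, rfl, rfl⟩
  | succ n ih =>
    have h := hA.t_hom
    rw [Function.iterate_succ']
    exact {
      map_meet := fun x y => by simp only [Function.comp_apply, ih.map_meet, h.map_meet]
      map_join := fun x y => by simp only [Function.comp_apply, ih.map_join, h.map_join]
      map_neg := fun x => by simp only [Function.comp_apply, ih.map_neg, h.map_neg]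
      map_star := fun x => by simp only [Function.comp_apply, ih.map_star, h.map_star]
      map_zero := by simp only [Function.comp_apply, ih.map_zero, h.map_zero]
      map_one := by simp only [Function.comp_apply, ih.map_one, h.map_one] }

/-- A homomorphism of `mpM`-algebras from a `C_k`-algebra to `T` extends to a homomorphism to
the cyclic power `T^k`. -/
theorem IsMpMHom.exists_ckHom_cyclicPower {k : ℕ} (hk : 1 ≤ k) {A : Type u} {T : Type v}
    [CkOps A] [MpMOps T] (hA : IsCkAlgebra k A) {h : A → T} (hh : IsMpMHom h) :
    ∃ H : A → CyclicPower T k, IsCkHom H ∧ ∀ x y, H x = H y → h x = h y := by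
  obtain ⟨n, rfl⟩ := Nat.exists_eq_add_of_le' hk
  have ht := fun i : Fin (n + 1) => hA.t_iterate_hom (n + 1 - i)
  -- The exponent k - i stands for -i modulo k. Applying t raises it by one, which moves to
  -- coordinate i - 1, and coordinate 0 is h (t^k x) = h x.
  refine ⟨fun x i => h (t^[n + 1 - i] x), ?_, fun x y hxy => ?_⟩
  · exact {
      map_meet := fun x y => funext fun i => by
        rw [(ht i).map_meet, hh.map_meet]; rfl
      map_join := fun x y => funext fun i => by
        rw [(ht i).map_join, hh.map_join]; rfl
      map_neg := fun x => funext fun i => by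
        rw [(ht i).map_neg, hh.map_neg]; rfl
      map_star := fun x => funext fun i => by
        rw [(ht i).map_star, hh.map_star]; rfl
      map_zero := funext fun i => by
        rw [(ht i).map_zero, hh.map_zero]; rfl
      map_one := funext fun i => by
        rw [(ht i).map_one, hh.map_one]; rfl
      map_t := fun x => funext fun i => by
        change h (t^[n + 1 - i] (t x)) =
          h (t^[n + 1 - ((finRotate (n + 1)).symm i : Fin (n + 1))] x)
        obtain ⟨j, rfl⟩ := (finRotate (n + 1)).surjective i
        rw [Equiv.symm_apply_apply, ← Function.iterate_succ_apply]
        by_cases hj : j = Fin.last n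
        -- The wrap-around: t^(k+1) x = t x, and the last coordinate has exponent k - (k - 1) = 1.
        · subst hj
          rw [finRotate_last, Fin.val_zero, Fin.val_last, Nat.sub_zero,
            Function.iterate_succ_apply', hA.t_iterate, Nat.add_sub_cancel_left]
          rfl
        · rw [coe_finRotate_of_ne_last hj]
          have := Fin.val_lt_last hj
          congr 2
          omega }
  · have h₀ := congrFun hxy 0
    simp only [Fin.val_zero, Nat.sub_zero, hA.t_iterate] at h₀
    exact h₀

/-- Distinct elements of a `C_k`-algebra are separated by a homomorphism to `T_{3,k}` or
`T_{4,k}`. -/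
theorem IsCkAlgebra.exists_separating_hom {k : ℕ} (hk : 1 ≤ k) {A : Type u} [CkOps A]
    (hA : IsCkAlgebra k A) {a b : A} (hab : a ≠ b) :
    (∃ h : A → CyclicPower T3 k, IsCkHom h ∧ h a ≠ h b) ∨
      (∃ h : A → CyclicPower T4 k, IsCkHom h ∧ h a ≠ h b) := by
  rcases hA.isMpM.exists_separating_hom hab with ⟨h, hh, hne⟩ | ⟨h, hh, hne⟩ <;>
  obtain ⟨H, hH, hsep⟩ := hh.exists_ckHom_cyclicPower hk hA
  · exact Or.inl ⟨H, hH, fun e => hne (hsep _ _ e)⟩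
  · exact Or.inr ⟨H, hH, fun e => hne (hsep _ _ e)⟩

/-! ### Finite generation -/

/-- The generating algebras live in `Type`, while members of the class have carriers in `Type u`. -/
instance uliftCkOps (A : Type v) [CkOps A] : CkOps (ULift.{u} A) where
  meet x y := ⟨meet x.down y.down⟩
  join x y := ⟨join x.down y.down⟩
  neg x := ⟨neg x.down⟩
  star x := ⟨star x.down⟩
  zero := ⟨zero⟩
  one := ⟨one⟩
  t x := ⟨t x.down⟩

theorem isCkHom_down (A : Type v) [CkOps A] : IsCkHom (ULift.down : ULift.{u} A → A) where
  map_meet _ _ := rfl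
  map_join _ _ := rfl
  map_neg _ := rfl
  map_star _ := rfl
  map_zero := rfl
  map_one := rfl
  map_t _ := rfl

theorem isCkHom_up (A : Type v) [CkOps A] : IsCkHom (ULift.up : A → ULift.{u} A) where
  map_meet _ _ := rfl
  map_join _ _ := rfl
  map_neg _ := rfl
  map_star _ := rfl
  map_zero := rfl
  map_one := rfl
  map_t _ := rfl

theorem IsCkHom.pi {A : Type*} {ι : Type v} {F : ι → Type u} [CkOps A] [∀ i, CkOps (F i)]
    {f : ∀ i, A → F i} (hf : ∀ i, IsCkHom (f i)) : IsCkHom (fun x i => f i x) where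
  map_meet x y := funext fun i => (hf i).map_meet x y
  map_join x y := funext fun i => (hf i).map_join x y
  map_neg x := funext fun i => (hf i).map_neg x
  map_star x := funext fun i => (hf i).map_star x
  map_zero := funext fun i => (hf i).map_zero
  map_one := funext fun i => (hf i).map_one
  map_t x := funext fun i => (hf i).map_t x

/-- An algebra whose elements are separated by homomorphisms to members of a variety belongs to
that variety. -/
theorem IsVariety.mem_of_separating {V : Set CkTypeAlg.{u}} (hV : IsVariety V)
    (A : CkTypeAlg.{u}) (hsep : ∀ a b : A.carrier, a ≠ b →
      ∃ B ∈ V, ∃ f : A.carrier → B.carrier, IsCkHom f ∧ f a ≠ f b) : A ∈ V := by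
  -- One coordinate for each pair of distinct elements makes the product map injective.
  choose B hBV f hf hne using fun i : {i : A.carrier × A.carrier // i.1 ≠ i.2} =>
    hsep i.1.1 i.1.2 i.2
  have hhom := IsCkHom.pi hf
  have hinj : Function.Injective fun x i => f i x := fun a b h => by
    by_contra hab
    exact hne ⟨(a, b), hab⟩ (congrFun h ⟨(a, b), hab⟩)
  -- Closure under isomorphism is a case of closure under homomorphic images.
  obtain ⟨g, hg, hbij⟩ := (hhom.ckIsomorphic_range hinj).symm
  exact hV.image_mem _ _ (hV.sub_mem _ (hV.prod_mem _ B hBV) hhom.range) ⟨g, hg, hbij.2⟩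

theorem isFinitelyGeneratedVariety_ckAlgebras {k : ℕ} (hk : 1 ≤ k) :
    IsFinitelyGeneratedVariety (ckAlgebras.{u} k) := by
  refine ⟨{⟨ULift.{u} (CyclicPower T3 k)⟩, ⟨ULift.{u} (CyclicPower T4 k)⟩},
    Set.toFinite _, ?_, Set.Subset.antisymm ?_ ?_⟩
  · rintro A (rfl | rfl)
    · exact inferInstanceAs (Finite (ULift _))
    · exact inferInstanceAs (Finite (ULift _))
  · intro A hA V hV hKV
    refine hV.mem_of_separating A fun a b hab => ?_
    rcases IsCkAlgebra.exists_separating_hom hk hA hab with ⟨h, hh, hne⟩ | ⟨h, hh, hne⟩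
    · exact ⟨_, hKV (Or.inl rfl), ULift.up ∘ h, (isCkHom_up _).comp hh,
        fun e => hne (ULift.up_injective e)⟩
    · exact ⟨_, hKV (Or.inr rfl), ULift.up ∘ h, (isCkHom_up _).comp hh,
        fun e => hne (ULift.up_injective e)⟩
  · intro A hA
    refine hA _ (isVariety_ckAlgebras hk) ?_
    rintro B (rfl | rfl)
    · exact IsCkAlgebra.of_injective hk (CyclicPower.isCkAlgebra isMpMAlgebra_T3 hk)
        (isCkHom_down _) ULift.down_injective
    · exact IsCkAlgebra.of_injective hk (CyclicPower.isCkAlgebra isMpMAlgebra_T4 hk)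
        (isCkHom_down _) ULift.down_injective

/-! ### Local finiteness -/

/-- On the subalgebra generated by a finite set, there are only finitely many restrictions of
homomorphisms to a finite algebra. -/
theorem finite_restrict_ckHom {A : Type u} [CkOps A] {B : Type v} [CkOps B] [Finite B]
    {X : Set A} (hX : X.Finite) :
    (Set.range fun f : {f : A → B // IsCkHom f} => (ckGenerated X).domRestrict f.1).Finite := by
  have := hX.to_subtype
  -- Restricting further to X lands in the finite set of maps X → B. This loses nothing, because the
  -- equalizer of two homomorphisms is a subalgebra, and it contains X when they agree there.
  refine Set.Finite.of_finite_image (f := fun g (x : X) => g ⟨x, fun S hS => hS x.2⟩)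
    (Set.toFinite _) ?_
  rintro _ ⟨⟨f, hf⟩, rfl⟩ _ ⟨⟨g, hg⟩, rfl⟩ h
  funext ⟨a, ha⟩
  exact ha (hf.equalizer hg) fun x hx => congrFun h ⟨x, hx⟩

theorem isLocallyFiniteClass_ckAlgebras {k : ℕ} (hk : 1 ≤ k) :
    IsLocallyFiniteClass (ckAlgebras.{u} k) := by
  intro A hA X hX
  have := (finite_restrict_ckHom (B := CyclicPower T3 k) hX).to_subtype
  have := (finite_restrict_ckHom (B := CyclicPower T4 k) hX).to_subtype
  let R₃ := Set.range fun f : {f : A.carrier → CyclicPower T3 k // IsCkHom f} =>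
    (ckGenerated X).domRestrict f.1
  let R₄ := Set.range fun f : {f : A.carrier → CyclicPower T4 k // IsCkHom f} =>
    (ckGenerated X).domRestrict f.1
  -- Evaluation at the finitely many restricted homomorphisms; separation makes it injective into a
  -- finite set.
  let Φ : ckGenerated X → (R₃ → CyclicPower T3 k) × (R₄ → CyclicPower T4 k) :=
    fun a => (fun g => g.1 a, fun g => g.1 a)
  rw [← Set.finite_coe_iff]
  refine Finite.of_injective Φ fun a b hab => ?_
  by_contra hne
  rcases IsCkAlgebra.exists_separating_hom hk hA (fun e => hne (Subtype.ext e)) with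
    ⟨h, hh, hsep⟩ | ⟨h, hh, hsep⟩
  · exact hsep (congrFun (congrArg Prod.fst hab) ⟨_, ⟨h, hh⟩, rfl⟩)
  · exact hsep (congrFun (congrArg Prod.snd hab) ⟨_, ⟨h, hh⟩, rfl⟩)

/-! ### Simple algebras -/

/-- The necessity operator `x ∧ (∼x)*`. -/
def MpMOps.nec {A : Type u} [MpMOps A] (x : A) : A := meet x (star (neg x))

/-- The possibility operator `∼□∼x`. -/
def MpMOps.pos {A : Type u} [MpMOps A] (x : A) : A := neg (nec (neg x))

/-- A term which, on `T_3` and on `T_4`, is the characteristic function of equality. -/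
def MpMOps.eqTerm {A : Type u} [MpMOps A] (x y : A) : A :=
  meet (join (nec (meet x y)) (neg (nec (join x y))))
    (join (pos (meet x y)) (neg (pos (join x y))))

/-- `⋀_{j < n} t^j x`. -/
def CkOps.meetOrbit {A : Type u} [CkOps A] (x : A) : ℕ → A
  | 0 => one
  | n + 1 => meet (t^[n] x) (meetOrbit x n)

theorem IsMpMHom.map_eqTerm {A : Type u} {B : Type v} [MpMOps A] [MpMOps B] {f : A → B}
    (hf : IsMpMHom f) (x y : A) : f (eqTerm x y) = eqTerm (f x) (f y) := by
  simp only [eqTerm, nec, pos, hf.map_meet, hf.map_join, hf.map_neg, hf.map_star]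

theorem IsCkHom.map_meetOrbit {A : Type u} {B : Type v} [CkOps A] [CkOps B] {f : A → B}
    (hf : IsCkHom f) (x : A) (n : ℕ) : f (meetOrbit x n) = meetOrbit (f x) n := by
  induction n with
  | zero => exact hf.map_one
  | succ n ih => rw [meetOrbit, hf.map_meet, hf.iterate_t, ih]; rfl

theorem IsCkCongruence.eqTerm_congr {A : Type u} [CkOps A] {θ : Setoid A}
    (hθ : IsCkCongruence θ) {x x' y y' : A} (hx : θ x x') (hy : θ y y') :
    θ (eqTerm x y) (eqTerm x' y') := by
  have nec_congr : ∀ {x x' : A}, θ x x' → θ (nec x) (nec x') := fun h =>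
    hθ.meet_congr h (hθ.star_congr (hθ.neg_congr h))
  have pos_congr : ∀ {x x' : A}, θ x x' → θ (pos x) (pos x') := fun h =>
    hθ.neg_congr (nec_congr (hθ.neg_congr h))
  have hm := hθ.meet_congr hx hy
  have hj := hθ.join_congr hx hy
  exact hθ.meet_congr (hθ.join_congr (nec_congr hm) (hθ.neg_congr (nec_congr hj)))
    (hθ.join_congr (pos_congr hm) (hθ.neg_congr (pos_congr hj)))

theorem IsCkCongruence.meetOrbit_congr {A : Type u} [CkOps A] {θ : Setoid A}
    (hθ : IsCkCongruence θ) {x x' : A} (hx : θ x x') (n : ℕ) :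
    θ (meetOrbit x n) (meetOrbit x' n) := by
  have ht : ∀ n, θ (t^[n] x) (t^[n] x') := fun n => by
    induction n with
    | zero => exact hx
    | succ n ih => simp only [Function.iterate_succ_apply']; exact hθ.t_congr ih
  induction n with
  | zero => exact θ.refl _
  | succ n ih => exact hθ.meet_congr (ht n) ih

namespace CyclicPower

variable {T : Type u} [MpMOps T] {k : ℕ}

theorem isMpMHom_eval (i : Fin k) : IsMpMHom (fun x : CyclicPower T k => x i) where
  map_meet _ _ := rfl
  map_join _ _ := rfl
  map_neg _ := rfl
  map_star _ := rfl
  map_zero := rfl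
  map_one := rfl

theorem meetOrbit_one (hT : IsMpMAlgebra T) (n : ℕ) :
    meetOrbit (one : CyclicPower T k) n = one := by
  have ht : ∀ n, t^[n] (one : CyclicPower T k) = one := fun n =>
    Function.iterate_fixed rfl n
  induction n with
  | zero => rfl
  | succ n ih =>
    rw [meetOrbit, ht, ih]
    exact funext fun _ => hT.one_meet _

/-- The k shifts carry the zero at i₀ to every coordinate, so each coordinate of the meet has a zero
factor. -/
theorem meetOrbit_eq_zero (hT : IsMpMAlgebra T) {x : CyclicPower T k} {i₀ : Fin k}
    (hx : x i₀ = zero) : meetOrbit x k = zero := by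
  have key : ∀ (i : Fin k) (n j : ℕ), j < n → (finRotate k).symm^[j] i = i₀ →
      meetOrbit x n i = zero := by
    intro i n
    induction n with
    | zero => intro j hj; omega
    | succ n ih =>
      intro j hj hi
      change meet ((t^[n] x) i) (meetOrbit x n i) = zero
      rcases Nat.lt_succ_iff_lt_or_eq.1 hj with hj | rfl
      · rw [ih j hj hi, hT.meet_zero]
      · rw [t_iterate_apply, hi, hx]; exact hT.zero_le _
  funext i
  obtain _ | n := k
  · exact i.elim0
  -- The shift by j = i - i₀ reads coordinate i - j = i₀.
  · refine key i (n + 1) (i - i₀ : Fin (n + 1)) (Fin.is_lt _) ?_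
    rw [finRotate_symm_iterate, Fin.ofNat_val_eq_self, sub_sub_cancel]

/-- If `eqTerm` is the characteristic function of equality on `T`, then every algebra that
embeds in `T^k` is simple. -/
theorem isCkSimple_of_injective (hT : IsMpMAlgebra T) (h01 : (zero : T) ≠ one)
    (eqTerm_self : ∀ x : T, eqTerm x x = one)
    (eqTerm_ne : ∀ x y : T, x ≠ y → eqTerm x y = zero) (hk : 1 ≤ k)
    {A : Type v} [CkOps A] {f : A → CyclicPower T k} (hf : IsCkHom f)
    (hinj : Function.Injective f) : IsCkSimple A := by
  have hA := (CyclicPower.isCkAlgebra hT hk).of_injective hk hf hinj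
  refine ⟨⟨zero, one, fun h => ?_⟩, fun θ hθ => or_iff_not_imp_left.2 fun hbot => ?_⟩
  · have h := congrArg f h
    rw [hf.map_zero, hf.map_one] at h
    exact h01 (congrFun h ⟨0, hk⟩)
  · have ⟨x, y, hxy, hne⟩ : ∃ x y, θ x y ∧ x ≠ y := by
      by_contra! h
      exact hbot (le_bot_iff.1 fun x y hxy => h x y hxy)
    obtain ⟨i₀, hi₀⟩ := Function.ne_iff.1 (hinj.ne hne)
    have hone : meetOrbit (eqTerm x x) k = one := hinj (by
      have : eqTerm (f x) (f x) = one := funext fun i =>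
        ((isMpMHom_eval i).map_eqTerm _ _).trans (eqTerm_self _)
      rw [hf.map_meetOrbit, hf.map_eqTerm, hf.map_one, this, meetOrbit_one hT])
    have hzero : meetOrbit (eqTerm x y) k = zero := hinj (by
      rw [hf.map_meetOrbit, hf.map_eqTerm, hf.map_zero]
      exact meetOrbit_eq_zero hT (i₀ := i₀)
        (((isMpMHom_eval i₀).map_eqTerm _ _).trans (eqTerm_ne _ _ hi₀)))
    -- Replacing the second x by the congruent y in the orbit meet of `eqTerm x x` turns 1 into 0.
    have hθ01 : θ one zero := by
      rw [← hone, ← hzero]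
      exact hθ.meetOrbit_congr (hθ.eqTerm_congr (θ.refl x) hxy) k
    have hθ0 : ∀ z, θ z zero := fun z => by
      have h := hθ.meet_congr (θ.refl z) hθ01
      rwa [hA.isMpM.le_one, hA.isMpM.meet_zero] at h
    exact top_le_iff.1 fun a b _ => θ.trans (hθ0 a) (θ.symm (hθ0 b))

end CyclicPower

/-! ### The equality term on the two generating algebras -/

theorem T3.eqTerm_self (x : T3) : eqTerm x x = MpMOps.one := by
  rcases x with _ | _ | _ <;> rfl

/-- `nec` sends everything but 1 to 0, and `pos` everything but 0 to 1. The term tests whether x ∧ y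
and x ∨ y agree under both, and these two maps together tell 0, a and 1 apart. -/
theorem T3.eqTerm_ne (x y : T3) (h : x ≠ y) : eqTerm x y = MpMOps.zero := by
  rcases x with _ | _ | _ <;> rcases y with _ | _ | _ <;> first | rfl | exact absurd rfl h

theorem T4.eqTerm_self (x : T4) : eqTerm x x = MpMOps.one := by
  rcases x with _ | _ | _ | _ <;> rfl

/-- Neither `nec` nor `pos` distinguishes a from b. Comparing x ∧ y with x ∨ y avoids this, since
for x ≠ y the first is strictly below the second. -/
theorem T4.eqTerm_ne (x y : T4) (h : x ≠ y) : eqTerm x y = MpMOps.zero := by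
  rcases x with _ | _ | _ | _ <;> rcases y with _ | _ | _ | _ <;>
    first | rfl | exact absurd rfl h

/-- A homomorphism from a simple algebra which is not constant is injective. -/
theorem IsCkSimple.injective {A : Type u} {B : Type v} [CkOps A] [CkOps B]
    (hA : IsCkSimple A) {f : A → B} (hf : IsCkHom f) {a b : A} (hab : f a ≠ f b) :
    Function.Injective f := by
  rcases hA.2 _ hf.isCkCongruence_ker with h | h
  · exact Setoid.ker_eq_bot_iff.1 h
  · refine absurd ?_ hab
    have : Setoid.ker f a b := h ▸ trivial
    exact this

/-- Nontriviality supplies a pair to separate; the separating homomorphism is then not constant,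
hence injective by simplicity. In the other direction, composing with the inclusion gives an
embedding in a cyclic power, to which `isCkSimple_of_injective` applies. -/
theorem isCkAlgebra_and_isCkSimple_iff {k : ℕ} (hk : 1 ≤ k) (A : Type u) [CkOps A] :
    (IsCkAlgebra k A ∧ IsCkSimple A) ↔
      ((∃ S : CkSubalgebra (CyclicPower T3 k), CkIsomorphic A S.carrier) ∨
        (∃ S : CkSubalgebra (CyclicPower T4 k), CkIsomorphic A S.carrier)) := by
  constructor
  · rintro ⟨hA, hsimple⟩
    obtain ⟨a, b, hab⟩ := hsimple.1
    rcases hA.exists_separating_hom hk hab with ⟨h, hh, hne⟩ | ⟨h, hh, hne⟩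
    · exact Or.inl ⟨_, hh.ckIsomorphic_range (hsimple.injective hh hne)⟩
    · exact Or.inr ⟨_, hh.ckIsomorphic_range (hsimple.injective hh hne)⟩
  · rintro (⟨S, f, hf, hbij⟩ | ⟨S, f, hf, hbij⟩)
    · have hg := S.isCkHom_val.comp hf
      have hinj := Subtype.val_injective.comp hbij.1
      exact ⟨(CyclicPower.isCkAlgebra isMpMAlgebra_T3 hk).of_injective hk hg hinj,
        CyclicPower.isCkSimple_of_injective isMpMAlgebra_T3 T3.noConfusion T3.eqTerm_self
          T3.eqTerm_ne hk hg hinj⟩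
    · have hg := S.isCkHom_val.comp hf
      have hinj := Subtype.val_injective.comp hbij.1
      exact ⟨(CyclicPower.isCkAlgebra isMpMAlgebra_T4 hk).of_injective hk hg hinj,
        CyclicPower.isCkSimple_of_injective isMpMAlgebra_T4 T4.noConfusion T4.eqTerm_self
          T4.eqTerm_ne hk hg hinj⟩

theorem mainTheorem2 (k : ℕ) (hk : 1 ≤ k) :
    IsVariety (ckAlgebras.{u} k) ∧
    IsFinitelyGeneratedVariety (ckAlgebras.{u} k) ∧
    IsLocallyFiniteClass (ckAlgebras.{u} k) ∧
    ∀ (A : Type u) [CkOps A],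
      (IsCkAlgebra k A ∧ IsCkSimple A) ↔
        ((∃ S : CkSubalgebra (CyclicPower T3 k), CkIsomorphic A S.carrier) ∨
          (∃ S : CkSubalgebra (CyclicPower T4 k), CkIsomorphic A S.carrier)) :=
  ⟨isVariety_ckAlgebras hk, isFinitelyGeneratedVariety_ckAlgebras hk,
    isLocallyFiniteClass_ckAlgebras hk, fun A _ => isCkAlgebra_and_isCkSimple_iff hk A⟩
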